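/- Let $n\ge 1$ be an integer, $T>0$, $I=[0,T]$, $J=[0,2T]$, and let $a_0,\dots,a_{2n-1}\in L^1(I)$ be real-valued. Put $$Lu=u^{(2n)}+a_{2n-1}u^{(2n-1)}+\dots+a_1u'+a_0u\quad\text{on } I,$$ and let $\widetilde L$ be the operator of the same form on $J$ in which each coefficient $a_{2k}$ is replaced by its even extension about $T$, $t\mapsto a_{2k}(2T-t)$ for $t\in(T,2T]$, and each $a_{2k+1}$ by its odd extension about $T$, $t\mapsto -a_{2k+1}(2T-t)$ for $t\in (T,2T]$. For $\ell>0$ let $W^{2n,1}([0,\ell])$ be the set of $u\in C^{2n-1}([0,\ell])$ with $u^{(2n-1)}$ absolutely continuous, and consider in it the following boundary conditions, for $k=0,\dots,n-1$: * Neumann ($N$): $u^{(2k+1)}(0)=u^{(2k+1)}(\ell)=0$; * Dirichlet ($D$): $u^{(2k)}(0)=u^{(2k)}(\ell)=0$; * Mixed 1 ($M_1$): $u^{(2k+1)}(0)=u^{(2k)}(\ell)=0$; * Mixed 2 ($M_2$): $u^{(2k)}(0)=u^{(2k+1)}(\ell)=0$. An operator is nonresonant for one of these problems if the homogeneous equation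 (satisfied a.e.) has only the trivial solution in $W^{2n,1}([0,\ell])$ under these boundary conditions. In that case its Green's function is the unique continuous function $G$ on $[0,\ell]^2$ such that, for every $\sigma\in L^1([0,\ell])$, $u(t)=\int_0^{\ell}G(t,s)\sigma(s)\,ds$ is the unique solution of the problem with right-hand side $\sigma$. Denote by $G_N[T],G_D[T],G_{M_1}[T],G_{M_2}[T]$ the Green's functions of $L$ on $I$, and by $G_N[2T],G_D[2T]$ those of $\widetilde L$ on $J$; in each item below, the operators are assumed nonresonant for the problems whose Green's functions appear in items 1–2, respectively 3–4. 1. If $G_N[2T]\ge 0$ on $J\times J$, then $G_N[T](t,s)\ge |G_{M_1}[T](t,s)|$ for all $(t,s)\in I\times I$. 2. If $G_N[2T]\le 0$ on $J\times J$, then $G_N[T](t,s)\le -|G_{M_1}[T](t,s)|$ for all $(t,s)\in I\times I$, with strict inequality at every $(t,s)\in I\times I$ such that $G_N[2T](t,s)\ne 0$ and $G_N[2T](2T-t,s)\neq 0$. 3. If $G_D[2T]\le 0$ on $J\times J$, then $G_{M_2}[T](t,s)\le -|G_D[T](t,s)|$ for all $(t,s)\in I\times I$, with strict inequality at every $(t,s)\in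 I\times I$ such that $G_D[2T](t,s)\ne 0$ and $G_D[2T](2T-t,s)\neq 0$. 4. If $G_D[2T]\ge 0$ on $J\times J$, then $G_{M_2}[T](t,s)\ge |G_D[T](t,s)|$ for all $(t,s)\in I\times I$. -/

import Mathlib

open Set MeasureTheory

noncomputable section

/-- The space `W^{2n,1}([0,ℓ])`: functions of class `C^{2n-1}` on `[0,ℓ]` whose derivative of
order `2n-1` is absolutely continuous there. Only the values on `[0,ℓ]` matter; derivatives at
the end points are one-sided. -/
def SobolevW (n : ℕ) (ℓ : ℝ) : Set (ℝ → ℝ) :=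
  {u | ContDiffOn ℝ ((2 * n - 1 : ℕ) : WithTop ℕ∞) u (Icc 0 ℓ) ∧
    AbsolutelyContinuousOnInterval (iteratedDerivWithin (2 * n - 1) u (Icc 0 ℓ)) 0 ℓ}

/-- The operator `L u = u^{(2n)} + a_{2n-1} u^{(2n-1)} + ⋯ + a_1 u' + a_0 u` on `[0,ℓ]`. -/
def linOp (n : ℕ) (ℓ : ℝ) (a : Fin (2 * n) → ℝ → ℝ) (u : ℝ → ℝ) (t : ℝ) : ℝ :=
  iteratedDerivWithin (2 * n) u (Icc 0 ℓ) t +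
    ∑ k : Fin (2 * n), a k t * iteratedDerivWithin (k : ℕ) u (Icc 0 ℓ) t

/-- `L u = σ` almost everywhere on `[0,ℓ]`. -/
def SolvesAE (n : ℕ) (ℓ : ℝ) (a : Fin (2 * n) → ℝ → ℝ) (u σ : ℝ → ℝ) : Prop :=
  ∀ᵐ t ∂(volume.restrict (Icc 0 ℓ)), linOp n ℓ a u t = σ t

/-- Even extension, about the point `T`, of a function on `[0,T]` to `[0,2T]`. -/
def evenExt (T : ℝ) (f : ℝ → ℝ) (t : ℝ) : ℝ := if t ≤ T then f t else f (2 * T - t)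

/-- Odd extension, about the point `T`, of a function on `[0,T]` to `[0,2T]`
(up to the value at the single point `T`). -/
def oddExt (T : ℝ) (f : ℝ → ℝ) (t : ℝ) : ℝ := if t ≤ T then f t else -f (2 * T - t)

/-- The coefficients on `[0,2T]` of the extended operator `L̃`: even extensions of the
coefficients with even index, odd extensions of those with odd index. -/
def extCoeff (n : ℕ) (T : ℝ) (a : Fin (2 * n) → ℝ → ℝ) : Fin (2 * n) → ℝ → ℝ :=
  fun k => if Even (k : ℕ) then evenExt T (a k) else oddExt T (a k)

/-- Neumann conditions on `[0,ℓ]`: `u^{(2k+1)}(0) = u^{(2k+1)}(ℓ) = 0`, `k = 0, …, n-1`. -/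
def spaceN (n : ℕ) (ℓ : ℝ) : Set (ℝ → ℝ) :=
  {u | u ∈ SobolevW n ℓ ∧ ∀ k < n,
    iteratedDerivWithin (2 * k + 1) u (Icc 0 ℓ) 0 = 0 ∧
    iteratedDerivWithin (2 * k + 1) u (Icc 0 ℓ) ℓ = 0}

/-- Dirichlet conditions on `[0,ℓ]`: `u^{(2k)}(0) = u^{(2k)}(ℓ) = 0`, `k = 0, …, n-1`. -/
def spaceD (n : ℕ) (ℓ : ℝ) : Set (ℝ → ℝ) :=
  {u | u ∈ SobolevW n ℓ ∧ ∀ k < n,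
    iteratedDerivWithin (2 * k) u (Icc 0 ℓ) 0 = 0 ∧
    iteratedDerivWithin (2 * k) u (Icc 0 ℓ) ℓ = 0}

/-- First mixed conditions on `[0,ℓ]`: `u^{(2k+1)}(0) = u^{(2k)}(ℓ) = 0`, `k = 0, …, n-1`. -/
def spaceM₁ (n : ℕ) (ℓ : ℝ) : Set (ℝ → ℝ) :=
  {u | u ∈ SobolevW n ℓ ∧ ∀ k < n,
    iteratedDerivWithin (2 * k + 1) u (Icc 0 ℓ) 0 = 0 ∧
    iteratedDerivWithin (2 * k) u (Icc 0 ℓ) ℓ = 0}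

/-- Second mixed conditions on `[0,ℓ]`: `u^{(2k)}(0) = u^{(2k+1)}(ℓ) = 0`, `k = 0, …, n-1`. -/
def spaceM₂ (n : ℕ) (ℓ : ℝ) : Set (ℝ → ℝ) :=
  {u | u ∈ SobolevW n ℓ ∧ ∀ k < n,
    iteratedDerivWithin (2 * k) u (Icc 0 ℓ) 0 = 0 ∧
    iteratedDerivWithin (2 * k + 1) u (Icc 0 ℓ) ℓ = 0}

/-- `L` is nonresonant in `X`: the only `u ∈ X` with `L u = 0` a.e. on `[0,ℓ]` is zero. -/
def Nonresonant (n : ℕ) (ℓ : ℝ) (a : Fin (2 * n) → ℝ → ℝ) (X : Set (ℝ → ℝ)) : Prop :=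
  ∀ u ∈ X, SolvesAE n ℓ a u (fun _ => 0) → ∀ t ∈ Icc 0 ℓ, u t = 0

/-- `G` is the Green's function of the operator with coefficients `a` on `X`: the operator is
nonresonant in `X`, `G` is continuous on the square, and for every integrable `σ` the function
`t ↦ ∫₀^ℓ G(t,s) σ(s) ds` is the (by nonresonance, unique) solution in `X` of `L u = σ` a.e.
Continuity of the kernel, which holds since the order `2n` is at least two, is what determines
`G` at every point of the square. -/
structure IsGreenFunction (n : ℕ) (ℓ : ℝ) (a : Fin (2 * n) → ℝ → ℝ) (X : Set (ℝ → ℝ))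
    (G : ℝ → ℝ → ℝ) : Prop where
  nonresonant : Nonresonant n ℓ a X
  continuousOn : ContinuousOn (fun p : ℝ × ℝ => G p.1 p.2) (Icc 0 ℓ ×ˢ Icc 0 ℓ)
  solution : ∀ σ : ℝ → ℝ, IntegrableOn σ (Icc 0 ℓ) →
    (fun t => ∫ s in (0 : ℝ)..ℓ, G t s * σ s) ∈ X ∧
      SolvesAE n ℓ a (fun t => ∫ s in (0 : ℝ)..ℓ, G t s * σ s) σ

end

/-! The coefficients of the extended operator have the parity that makes it commute with the
reflection `t ↦ 2T - t`. Extend a datum on `[0,T]` with sign `ε = ±1` about `T` and solve on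
`[0,2T]` with the same conditions at both ends. By nonresonance the solution has the same symmetry:
if it is even about `T`, its odd derivatives vanish there; if it is odd, its even ones do. So it
restricts to the solution of a problem on `[0,T]` with the corresponding conditions at `T`
(`IsGreenFunction.integral_signExt`). Testing against all continuous data turns this into identities
between kernels (`IsGreenFunction.eq_add_reflect`). Combining both signs gives `Go = x + y` and `Ge
= x - y`, with `x = G₂(t,s)` and `y = G₂(2T-t,s)` (`IsGreenFunction.eq_add_and_eq_sub`). When `x`
and `y` have the same sign, `|x - y| ≤ |x + y|`, strictly if neither is zero. -/

/-! ### Absolute continuity and iterated derivatives under reflection. -/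

open AbsolutelyContinuousOnInterval in
lemma AbsolutelyContinuousOnInterval.congr_on {f g : ℝ → ℝ} {a b : ℝ}
    (hf : AbsolutelyContinuousOnInterval f a b) (h : EqOn f g (uIcc a b)) :
    AbsolutelyContinuousOnInterval g a b := by
  rw [absolutelyContinuousOnInterval_iff] at hf ⊢
  intro ε hε
  obtain ⟨δ, hδ, H⟩ := hf ε hε
  refine ⟨δ, hδ, fun E hE hl => ?_⟩
  convert H E hE hl using 1
  refine Finset.sum_congr rfl fun i hi => ?_
  rw [h (hE.1 i hi).1, h (hE.1 i hi).2]

lemma disjoint_uIoc_const_sub {a b c d : ℝ} (ℓ : ℝ) (h : Disjoint (uIoc a b) (uIoc c d)) :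
    Disjoint (uIoc (ℓ - a) (ℓ - b)) (uIoc (ℓ - c) (ℓ - d)) := by
  simp only [uIoc, Ioc_disjoint_Ioc, min_sub_sub_left, max_sub_sub_left] at h ⊢
  linarith

lemma sub_mem_Icc_zero {ℓ x : ℝ} (hx : x ∈ Icc 0 ℓ) : ℓ - x ∈ Icc 0 ℓ :=
  ⟨by linarith [hx.2], by linarith [hx.1]⟩

open AbsolutelyContinuousOnInterval in
lemma AbsolutelyContinuousOnInterval.comp_const_sub {f : ℝ → ℝ} {ℓ : ℝ} (hℓ : 0 ≤ ℓ)
    (hf : AbsolutelyContinuousOnInterval f 0 ℓ) :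
    AbsolutelyContinuousOnInterval (fun x => f (ℓ - x)) 0 ℓ := by
  rw [absolutelyContinuousOnInterval_iff] at hf ⊢
  intro ε hε
  obtain ⟨δ, hδ, H⟩ := hf ε hε
  refine ⟨δ, hδ, fun E hE hl => ?_⟩
  refine H (E.1, fun i => (ℓ - (E.2 i).1, ℓ - (E.2 i).2))
    ⟨fun i hi => ?_, fun i hi j hj hij => ?_⟩ ?_
  · have := hE.1 i hi
    simp only [uIcc_of_le hℓ] at this ⊢
    exact ⟨sub_mem_Icc_zero this.1, sub_mem_Icc_zero this.2⟩
  · exact disjoint_uIoc_const_sub ℓ (hE.2 hi hj hij)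
  · simpa only [dist_sub_left] using hl

open scoped Pointwise in
lemma iteratedDerivWithin_reflect (k : ℕ) (u : ℝ → ℝ) (ℓ t : ℝ) :
    iteratedDerivWithin k (fun x => u (ℓ - x)) (Icc 0 ℓ) t =
      (-1) ^ k * iteratedDerivWithin k u (Icc 0 ℓ) (ℓ - t) := by
  have h' : ℓ +ᵥ -Icc (0 : ℝ) ℓ = Icc 0 ℓ := by
    ext x
    rw [mem_vadd_set_iff_neg_vadd_mem, Set.mem_neg, vadd_eq_add, mem_Icc, mem_Icc]
    constructor <;> rintro ⟨h1, h2⟩ <;> constructor <;> linarith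
  simp only [iteratedDerivWithin_comp_const_sub, h', smul_eq_mul]

/-! ### Derivatives within a shorter interval. -/

section Restrict

variable {ℓ ℓ' : ℝ} {u : ℝ → ℝ} {m : ℕ}

lemma iteratedDerivWithin_Icc_eq_of_le (h0 : 0 < ℓ) (hℓ : ℓ ≤ ℓ')
    (hu : ContDiffOn ℝ m u (Icc 0 ℓ')) {k : ℕ} (hk : k ≤ m) {t : ℝ} (ht : t ∈ Icc 0 ℓ) :
    iteratedDerivWithin k u (Icc 0 ℓ) t = iteratedDerivWithin k u (Icc 0 ℓ') t := by
  rw [iteratedDerivWithin, iteratedDerivWithin,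
    iteratedFDerivWithin_subset (Icc_subset_Icc_right hℓ) (uniqueDiffOn_Icc h0)
      (uniqueDiffOn_Icc (h0.trans_le hℓ)) (hu.of_le (by exact_mod_cast hk)) ht]

/-- The two intervals coincide near an interior point, so no regularity is needed; this covers the
order `2n`, where the derivative exists only almost everywhere. -/
lemma iteratedDerivWithin_Icc_eq_of_mem_Ioo (hℓ : ℓ ≤ ℓ') (k : ℕ) {t : ℝ} (ht : t ∈ Ioo 0 ℓ) :
    iteratedDerivWithin k u (Icc 0 ℓ) t = iteratedDerivWithin k u (Icc 0 ℓ') t := by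
  rw [iteratedDerivWithin, iteratedDerivWithin, iteratedFDerivWithin_congr_set]
  filter_upwards [Ioo_mem_nhds ht.1 ht.2] with x hx
  exact propext ⟨fun h => ⟨h.1, h.2.trans hℓ⟩, fun h => ⟨h.1, hx.2.le⟩⟩

lemma ae_restrict_mem_Ioo (ℓ : ℝ) : ∀ᵐ t ∂(volume.restrict (Icc 0 ℓ)), t ∈ Ioo 0 ℓ := by
  rw [← Measure.restrict_congr_set (Ioo_ae_eq_Icc (μ := volume) (a := (0 : ℝ)) (b := ℓ))]
  exact ae_restrict_mem measurableSet_Ioo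

end Restrict

/-! ### Linearity, restriction and reflection for the equation and the boundary conditions. -/

section Sobolev

variable {n : ℕ} {ℓ ℓ' : ℝ} {u v σ τ : ℝ → ℝ} {a : Fin (2 * n) → ℝ → ℝ}

lemma iteratedDerivWithin_sub_of_mem (h0 : 0 < ℓ) (hu : u ∈ SobolevW n ℓ) (hv : v ∈ SobolevW n ℓ)
    {k : ℕ} (hk : k ≤ 2 * n - 1) {t : ℝ} (ht : t ∈ Icc 0 ℓ) :
    iteratedDerivWithin k (fun x => u x - v x) (Icc 0 ℓ) t =
      iteratedDerivWithin k u (Icc 0 ℓ) t - iteratedDerivWithin k v (Icc 0 ℓ) t :=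
  iteratedDerivWithin_sub ht (uniqueDiffOn_Icc h0) ((hu.1 t ht).of_le (by exact_mod_cast hk))
    ((hv.1 t ht).of_le (by exact_mod_cast hk))

lemma SobolevW.sub (h0 : 0 < ℓ) (hu : u ∈ SobolevW n ℓ) (hv : v ∈ SobolevW n ℓ) :
    (fun x => u x - v x) ∈ SobolevW n ℓ := by
  refine ⟨hu.1.sub hv.1, (hu.2.sub hv.2).congr_on fun t ht => ?_⟩
  rw [uIcc_of_le h0.le] at ht
  exact (iteratedDerivWithin_sub_of_mem h0 hu hv le_rfl ht).symm

lemma SobolevW.const_mul (c : ℝ) (hu : u ∈ SobolevW n ℓ) :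
    (fun x => c * u x) ∈ SobolevW n ℓ := by
  refine ⟨contDiffOn_const.mul hu.1, (hu.2.const_mul c).congr_on fun t _ => ?_⟩
  exact (iteratedDerivWithin_const_mul_field c u).symm

lemma SobolevW.reflect (h0 : 0 < ℓ) (hu : u ∈ SobolevW n ℓ) :
    (fun x => u (ℓ - x)) ∈ SobolevW n ℓ := by
  refine ⟨hu.1.comp (contDiff_const.sub contDiff_id).contDiffOn fun x hx => sub_mem_Icc_zero hx,
    ((hu.2.comp_const_sub h0.le).const_mul ((-1) ^ (2 * n - 1))).congr_on fun t _ => ?_⟩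
  exact (iteratedDerivWithin_reflect _ u ℓ t).symm

lemma SobolevW.restrict (h0 : 0 < ℓ) (hℓ : ℓ ≤ ℓ') (hu : u ∈ SobolevW n ℓ') :
    u ∈ SobolevW n ℓ := by
  have hs : Icc 0 ℓ ⊆ Icc 0 ℓ' := Icc_subset_Icc_right hℓ
  refine ⟨hu.1.mono hs, (hu.2.mono (c := 0) (d := ℓ) ?_).congr_on fun t ht => ?_⟩
  · rwa [uIcc_of_le h0.le, uIcc_of_le (h0.le.trans hℓ)]
  · rw [uIcc_of_le h0.le] at ht
    exact (iteratedDerivWithin_Icc_eq_of_le h0 hℓ hu.1 le_rfl ht).symm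

/-- The derivative of order `2n` of a difference, which exists almost everywhere. -/
lemma ae_iteratedDerivWithin_sub (hn : 1 ≤ n) (h0 : 0 < ℓ) (hu : u ∈ SobolevW n ℓ)
    (hv : v ∈ SobolevW n ℓ) :
    ∀ᵐ t ∂(volume.restrict (Icc 0 ℓ)),
      iteratedDerivWithin (2 * n) (fun x => u x - v x) (Icc 0 ℓ) t =
      iteratedDerivWithin (2 * n) u (Icc 0 ℓ) t - iteratedDerivWithin (2 * n) v (Icc 0 ℓ) t := by
  filter_upwards [ae_restrict_of_ae hu.2.ae_differentiableAt,
    ae_restrict_of_ae hv.2.ae_differentiableAt, ae_restrict_mem measurableSet_Icc] with t h1 h2 ht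
  rw [uIcc_of_le h0.le] at h1 h2
  -- Here `1 ≤ n` matters: `2 * n - 1` is a truncated subtraction.
  obtain ⟨m, hm⟩ : ∃ m, 2 * n = m + 1 := ⟨2 * n - 1, by omega⟩
  have hm' : m = 2 * n - 1 := by omega
  rw [hm, iteratedDerivWithin_succ, iteratedDerivWithin_succ, iteratedDerivWithin_succ, hm',
    ← derivWithin_fun_sub (h1 ht).differentiableWithinAt (h2 ht).differentiableWithinAt]
  exact derivWithin_congr (fun x hx => iteratedDerivWithin_sub_of_mem h0 hu hv le_rfl hx)
    (iteratedDerivWithin_sub_of_mem h0 hu hv le_rfl ht)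

lemma SolvesAE.sub (hn : 1 ≤ n) (h0 : 0 < ℓ) (hu : u ∈ SobolevW n ℓ) (hv : v ∈ SobolevW n ℓ)
    (h1 : SolvesAE n ℓ a u σ) (h2 : SolvesAE n ℓ a v τ) :
    SolvesAE n ℓ a (fun x => u x - v x) (fun x => σ x - τ x) := by
  unfold SolvesAE at *
  filter_upwards [h1, h2, ae_iteratedDerivWithin_sub hn h0 hu hv,
    ae_restrict_mem measurableSet_Icc] with t h1 h2 h3 ht
  rw [← h1, ← h2, linOp, linOp, linOp, h3, Finset.sum_congr rfl fun k _ => by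
    rw [iteratedDerivWithin_sub_of_mem h0 hu hv (by omega) ht, mul_sub], Finset.sum_sub_distrib]
  ring

lemma SolvesAE.const_mul (c : ℝ) (h : SolvesAE n ℓ a u σ) :
    SolvesAE n ℓ a (fun x => c * u x) (fun x => c * σ x) := by
  unfold SolvesAE at *
  filter_upwards [h] with t h
  simp only [← h, linOp, iteratedDerivWithin_const_mul_field, mul_add, Finset.mul_sum]
  congr 1
  exact Finset.sum_congr rfl fun k _ => by ring

lemma SolvesAE.restrict (hℓ : ℓ ≤ ℓ') {b : Fin (2 * n) → ℝ → ℝ}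
    (hab : ∀ k, EqOn (a k) (b k) (Icc 0 ℓ)) (h : SolvesAE n ℓ' b u σ) : SolvesAE n ℓ a u σ := by
  unfold SolvesAE at *
  filter_upwards [ae_restrict_of_ae_restrict_of_subset (Icc_subset_Icc_right hℓ) h,
    ae_restrict_mem_Ioo ℓ] with t h ht
  simp only [← h, linOp, iteratedDerivWithin_Icc_eq_of_mem_Ioo (u := u) hℓ _ ht,
    hab _ (Ioo_subset_Icc_self ht)]

lemma ae_restrict_reflect {p : ℝ → Prop} (h : ∀ᵐ t ∂(volume.restrict (Icc 0 ℓ)), p t) :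
    ∀ᵐ t ∂(volume.restrict (Icc 0 ℓ)), p (ℓ - t) := by
  have hq := (Measure.measurePreserving_sub_left volume ℓ).restrict_preimage
    (measurableSet_Icc (a := (0 : ℝ)) (b := ℓ))
  have : (fun x => ℓ - x) ⁻¹' Icc 0 ℓ = Icc 0 ℓ := by
    rw [preimage_const_sub_Icc]; simp
  rw [this] at hq
  exact hq.quasiMeasurePreserving.ae h

lemma extCoeff_eqOn {T : ℝ} (k : Fin (2 * n)) : EqOn (a k) (extCoeff n T a k) (Icc 0 T) := by
  intro t ht
  unfold extCoeff evenExt oddExt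
  split_ifs <;> simp [ht.2]

/-- The point `T` is excluded because `oddExt` keeps the value `f T` there, which need not be zero.
-/
lemma extCoeff_reflect {T : ℝ} (k : Fin (2 * n)) {t : ℝ} (ht : t ≠ T) :
    extCoeff n T a k (2 * T - t) = (-1) ^ (k : ℕ) * extCoeff n T a k t := by
  unfold extCoeff
  rcases Nat.even_or_odd (k : ℕ) with hk | hk
  · rw [if_pos hk, hk.neg_one_pow, one_mul, evenExt, evenExt]
    rcases lt_or_gt_of_ne ht with h | h
    · rw [if_neg (by linarith), if_pos h.le]; congr 1; ring
    · rw [if_pos (by linarith), if_neg (by linarith)]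
  · rw [if_neg (Nat.not_even_iff_odd.2 hk), hk.neg_one_pow, oddExt, oddExt]
    rcases lt_or_gt_of_ne ht with h | h
    · rw [if_neg (by linarith), if_pos h.le, neg_one_mul]; congr 2; ring
    · rw [if_pos (by linarith), if_neg (by linarith)]; ring

/-- The sign `(-1)^k` that reflection puts on the `k`-th derivative cancels the one on the `k`-th
coefficient, and the leading order `2n` is even. -/
lemma SolvesAE.reflect {T : ℝ} (h : SolvesAE n (2 * T) (extCoeff n T a) u σ) :
    SolvesAE n (2 * T) (extCoeff n T a) (fun x => u (2 * T - x)) (fun x => σ (2 * T - x)) := by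
  unfold SolvesAE at *
  have hT : ∀ᵐ t ∂(volume.restrict (Icc 0 (2 * T))), t ≠ T :=
    ae_restrict_of_ae (Measure.ae_ne volume T)
  filter_upwards [ae_restrict_reflect h, hT] with t h ht
  rw [← h, linOp, linOp]
  simp only [iteratedDerivWithin_reflect, extCoeff_reflect _ ht]
  rw [(even_two_mul n).neg_one_pow, one_mul]
  congr 1
  exact Finset.sum_congr rfl fun k _ => by ring

/-- Boundary conditions annihilating the derivatives of the parity of `p` at `0` and those of the
parity of `q` at `ℓ`. -/
def parSpace (p q n : ℕ) (ℓ : ℝ) : Set (ℝ → ℝ) :=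
  {u | u ∈ SobolevW n ℓ ∧ ∀ k < n,
    iteratedDerivWithin (2 * k + p) u (Icc 0 ℓ) 0 = 0 ∧
    iteratedDerivWithin (2 * k + q) u (Icc 0 ℓ) ℓ = 0}

variable {p q : ℕ}

lemma parSpace.sub (hp : p ≤ 1) (hq : q ≤ 1) (h0 : 0 < ℓ) (hu : u ∈ parSpace p q n ℓ)
    (hv : v ∈ parSpace p q n ℓ) : (fun x => u x - v x) ∈ parSpace p q n ℓ := by
  refine ⟨SobolevW.sub h0 hu.1 hv.1, fun k hk => ⟨?_, ?_⟩⟩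
  · rw [iteratedDerivWithin_sub_of_mem h0 hu.1 hv.1 (by omega) (left_mem_Icc.2 h0.le),
      (hu.2 k hk).1, (hv.2 k hk).1, sub_zero]
  · rw [iteratedDerivWithin_sub_of_mem h0 hu.1 hv.1 (by omega) (right_mem_Icc.2 h0.le),
      (hu.2 k hk).2, (hv.2 k hk).2, sub_zero]

lemma parSpace.const_mul (c : ℝ) (hu : u ∈ parSpace p q n ℓ) :
    (fun x => c * u x) ∈ parSpace p q n ℓ := by
  refine ⟨SobolevW.const_mul c hu.1, fun k hk => ?_⟩
  simp only [iteratedDerivWithin_const_mul_field, (hu.2 k hk).1, (hu.2 k hk).2, mul_zero, and_self]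

lemma parSpace.reflect (h0 : 0 < ℓ) (hu : u ∈ parSpace p q n ℓ) :
    (fun x => u (ℓ - x)) ∈ parSpace q p n ℓ := by
  refine ⟨SobolevW.reflect h0 hu.1, fun k hk => ?_⟩
  simp only [iteratedDerivWithin_reflect, sub_zero, sub_self, (hu.2 k hk).1, (hu.2 k hk).2,
    mul_zero, and_self]

/-- Solutions are determined by their right-hand side when the operator is nonresonant. -/
lemma Nonresonant.eqOn (hp : p ≤ 1) (hq : q ≤ 1) (hn : 1 ≤ n) (h0 : 0 < ℓ)
    (hL : Nonresonant n ℓ a (parSpace p q n ℓ)) (hu : u ∈ parSpace p q n ℓ)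
    (hv : v ∈ parSpace p q n ℓ) (h1 : SolvesAE n ℓ a u σ) (h2 : SolvesAE n ℓ a v τ)
    (hστ : ∀ᵐ t ∂(volume.restrict (Icc 0 ℓ)), σ t = τ t) : EqOn u v (Icc 0 ℓ) := by
  intro t ht
  refine sub_eq_zero.1 (hL _ (parSpace.sub hp hq h0 hu hv) ?_ t ht)
  have h3 := SolvesAE.sub hn h0 hu.1 hv.1 h1 h2
  unfold SolvesAE at h3 ⊢
  filter_upwards [h3, hστ] with s h h'
  rw [h, h', sub_self]

/-- A function of `[0,2T]` with the symmetry of sign `-(-1)^q` about `T` satisfies, on `[0,T]`, the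
conditions of parity `q` at `T`. -/
lemma parSpace.restrict {T : ℝ} (hT : 0 < T) (hp : p ≤ 1) (hq : q ≤ 1)
    (hu : u ∈ parSpace p p n (2 * T))
    (hsym : EqOn (fun x => u (2 * T - x)) (fun x => (-1) ^ (q + 1) * u x) (Icc 0 (2 * T))) :
    u ∈ parSpace p q n T := by
  have hT2 : T ≤ 2 * T := by linarith
  refine ⟨SobolevW.restrict hT hT2 hu.1, fun k hk => ⟨?_, ?_⟩⟩
  · rw [iteratedDerivWithin_Icc_eq_of_le hT hT2 hu.1.1 (by omega) (left_mem_Icc.2 hT.le),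
      (hu.2 k hk).1]
  · rw [iteratedDerivWithin_Icc_eq_of_le hT hT2 hu.1.1 (by omega) (right_mem_Icc.2 hT.le)]
    -- At the fixed point `T` the derivative `d` of order `2k+q` satisfies `(-1)^q d = (-1)^(q+1)
    -- d`, so `d = 0`.
    have h := iteratedDerivWithin_congr (n := 2 * k + q) hsym (x := T) ⟨hT.le, hT2⟩
    rw [iteratedDerivWithin_reflect, iteratedDerivWithin_const_mul_field,
      show 2 * T - T = T by ring, pow_add, pow_mul, neg_one_sq, one_pow, pow_succ] at h
    rcases neg_one_pow_eq_or ℝ q with h' | h' <;> rw [h'] at h <;> linarith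

end Sobolev

/-! ### From symmetric data to identities between Green's functions. -/

section Green

open intervalIntegral

lemma eqOn_zero_of_forall_integral_mul_eq_zero {T : ℝ} (hT : 0 < T) {f g : ℝ → ℝ}
    (hf : ContinuousOn f (Icc 0 T)) (hg : ContinuousOn g (Icc 0 T))
    (h : ∀ σ : ℝ → ℝ, ContinuousOn σ (Icc 0 T) →
      ∫ s in (0 : ℝ)..T, f s * σ s = ∫ s in (0 : ℝ)..T, g s * σ s) : EqOn f g (Icc 0 T) := by
  intro s hs
  by_contra hne
  -- The test function is `f - g` itself, whose square would have positive integral.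
  have hfg : ContinuousOn (fun x => f x - g x) (Icc 0 T) := hf.sub hg
  have hpos : 0 < ∫ x in (0 : ℝ)..T, (f x - g x) * (f x - g x) :=
    integral_pos hT (hfg.mul hfg) (fun x _ => mul_self_nonneg _)
      ⟨s, hs, mul_self_pos.2 (sub_ne_zero.2 hne)⟩
  have h1 := (hf.mul hfg).intervalIntegrable_of_Icc (μ := volume) hT.le
  have h2 := (hg.mul hfg).intervalIntegrable_of_Icc (μ := volume) hT.le
  have h3 := intervalIntegral.integral_sub h1 h2
  simp only [Pi.mul_apply] at h3
  rw [h _ hfg, sub_self] at h3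
  simp only [sub_mul] at hpos
  exact hpos.ne' h3

/-- Extension of sign `ε` about the point `T`. -/
noncomputable def signExt (ε T : ℝ) (σ : ℝ → ℝ) (t : ℝ) : ℝ :=
  if t ≤ T then σ t else ε * σ (2 * T - t)

lemma signExt_of_le {ε T : ℝ} {σ : ℝ → ℝ} {t : ℝ} (ht : t ≤ T) : signExt ε T σ t = σ t := if_pos ht

lemma signExt_of_lt {ε T : ℝ} {σ : ℝ → ℝ} {t : ℝ} (ht : T < t) :
    signExt ε T σ t = ε * σ (2 * T - t) := if_neg ht.not_ge

lemma signExt_reflect {ε T : ℝ} (hε : ε * ε = 1) {σ : ℝ → ℝ} {t : ℝ} (ht : t ≠ T) :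
    signExt ε T σ (2 * T - t) = ε * signExt ε T σ t := by
  rcases lt_or_gt_of_ne ht with h | h
  · rw [signExt_of_lt (by linarith), signExt_of_le h.le, show 2 * T - (2 * T - t) = t by ring]
  · rw [signExt_of_le (by linarith), signExt_of_lt h, ← mul_assoc, hε, one_mul]

variable {n p q : ℕ} {T ε : ℝ} {a : Fin (2 * n) → ℝ → ℝ} {G₂ G : ℝ → ℝ → ℝ} {σ : ℝ → ℝ}

lemma reflect_mem_Icc {T s : ℝ} (hT : 0 < T) (hs : s ∈ Icc 0 T) : 2 * T - s ∈ Icc 0 (2 * T) :=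
  ⟨by linarith [hs.2], by linarith [hs.1]⟩

lemma continuousOn_section {ℓ t : ℝ} (hG : ContinuousOn (fun p : ℝ × ℝ => G p.1 p.2)
    (Icc 0 ℓ ×ˢ Icc 0 ℓ)) (ht : t ∈ Icc 0 ℓ) : ContinuousOn (G t) (Icc 0 ℓ) :=
  hG.comp (f := fun s => (t, s)) (by fun_prop) fun _ hs => ⟨ht, hs⟩

lemma intervalIntegrable_mul_signExt (hT : 0 < T) {g : ℝ → ℝ} (hg : ContinuousOn g (Icc 0 (2 * T)))
    (hσ : ContinuousOn σ (Icc 0 T)) :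
    IntervalIntegrable (fun s => g s * signExt ε T σ s) volume 0 T ∧
      IntervalIntegrable (fun s => g s * signExt ε T σ s) volume T (2 * T) := by
  have hg1 := hg.mono (Icc_subset_Icc_right (by linarith : T ≤ 2 * T))
  have hg2 := hg.mono (Icc_subset_Icc_left hT.le : Icc T (2 * T) ⊆ _)
  have hσ' : ContinuousOn (fun s => σ (2 * T - s)) (Icc T (2 * T)) :=
    hσ.comp (by fun_prop) fun s hs => ⟨by linarith [hs.2], by linarith [hs.1]⟩
  constructor
  · refine ((hg1.mul hσ).intervalIntegrable_of_Icc hT.le).congr fun s hs => ?_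
    rw [uIoc_of_le hT.le] at hs
    simp only [signExt_of_le hs.2, Pi.mul_apply]
  · have h := (hg2.mul (continuousOn_const (c := ε) |>.mul hσ')).intervalIntegrable_of_Icc
      (μ := volume) (by linarith : T ≤ 2 * T)
    refine h.congr fun s hs => ?_
    rw [uIoc_of_le (by linarith)] at hs
    simp only [signExt_of_lt hs.1, Pi.mul_apply]

/-- Splitting at `T` and substituting `s ↦ 2T - s` on the right half folds the kernel onto `[0,T]`.
-/
lemma integral_mul_signExt (hT : 0 < T) {g : ℝ → ℝ} (hg : ContinuousOn g (Icc 0 (2 * T)))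
    (hσ : ContinuousOn σ (Icc 0 T)) :
    ∫ s in (0 : ℝ)..(2 * T), g s * signExt ε T σ s =
      ∫ s in (0 : ℝ)..T, (g s + ε * g (2 * T - s)) * σ s := by
  obtain ⟨i1, i2⟩ := intervalIntegrable_mul_signExt (ε := ε) hT hg hσ
  have hg1 := hg.mono (Icc_subset_Icc_right (by linarith : T ≤ 2 * T))
  have hg2 : ContinuousOn (fun s => g (2 * T - s)) (Icc 0 T) :=
    hg.comp (by fun_prop) fun s hs => reflect_mem_Icc hT hs
  rw [← integral_add_adjacent_intervals i1 i2]
  have e1 : ∫ s in (0 : ℝ)..T, g s * signExt ε T σ s = ∫ s in (0 : ℝ)..T, g s * σ s := by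
    refine integral_congr fun s hs => ?_
    rw [uIcc_of_le hT.le] at hs
    simp only [signExt_of_le hs.2]
  have e2 : ∫ s in T..(2 * T), g s * signExt ε T σ s =
      ∫ s in (0 : ℝ)..T, ε * g (2 * T - s) * σ s := by
    have h := integral_comp_sub_left (fun s => ε * g (2 * T - s) * σ s) (2 * T)
      (a := T) (b := 2 * T)
    rw [sub_self, show 2 * T - T = T by ring] at h
    rw [← h]
    refine integral_congr_ae (Filter.Eventually.of_forall fun s hs => ?_)
    rw [uIoc_of_le (by linarith)] at hs
    rw [signExt_of_lt hs.1, sub_sub_cancel]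
    ring
  rw [e1, e2, ← intervalIntegral.integral_add]
  · simp only [add_mul]
  · exact (hg1.mul hσ).intervalIntegrable_of_Icc hT.le
  · exact ((continuousOn_const.mul hg2).mul hσ).intervalIntegrable_of_Icc hT.le

/-- The solution on `[0,2T]` whose datum is an extension of sign `(-1)^(q+1)` has that symmetry, and
it restricts to the solution on `[0,T]` of the problem with conditions of parity `q` at `T`. -/
lemma IsGreenFunction.integral_signExt (hn : 1 ≤ n) (hT : 0 < T) (hp : p ≤ 1) (hq : q ≤ 1)
    (h₂ : IsGreenFunction n (2 * T) (extCoeff n T a) (parSpace p p n (2 * T)) G₂)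
    (h : IsGreenFunction n T a (parSpace p q n T) G) (hσ : ContinuousOn σ (Icc 0 T))
    {t : ℝ} (ht : t ∈ Icc 0 T) :
    ∫ s in (0 : ℝ)..(2 * T), G₂ t s * signExt ((-1) ^ (q + 1)) T σ s =
        ∫ s in (0 : ℝ)..T, G t s * σ s ∧
      ∫ s in (0 : ℝ)..(2 * T), G₂ (2 * T - t) s * signExt ((-1) ^ (q + 1)) T σ s =
        (-1) ^ (q + 1) * ∫ s in (0 : ℝ)..T, G t s * σ s := by
  have hT2 : T ≤ 2 * T := by linarith
  have hε : ((-1 : ℝ) ^ (q + 1)) * (-1) ^ (q + 1) = 1 := by rw [← mul_pow]; simp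
  set ε : ℝ := (-1) ^ (q + 1)
  set τ := signExt ε T σ
  have hτ : IntegrableOn τ (Icc 0 (2 * T)) := by
    -- The constant kernel `1` gives integrability of the extended datum itself.
    obtain ⟨i1, i2⟩ := intervalIntegrable_mul_signExt (ε := ε) hT (g := fun _ => 1)
      continuousOn_const hσ
    have := i1.trans i2
    simp only [one_mul] at this
    rwa [intervalIntegrable_iff_integrableOn_Icc_of_le (by linarith)] at this
  obtain ⟨hv, hLv⟩ := h₂.solution τ hτ
  obtain ⟨hw, hLw⟩ := h.solution σ (hσ.integrableOn_Icc)
  -- The reflected solution and `ε` times the solution solve the same problem; their data may differ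
  -- at `T` alone.
  have hsym := Nonresonant.eqOn hp hp hn (by linarith) h₂.nonresonant
    (parSpace.reflect (by linarith) hv) (parSpace.const_mul ε hv) (SolvesAE.reflect hLv)
    (SolvesAE.const_mul ε hLv)
    (by
      filter_upwards [ae_restrict_of_ae (Measure.ae_ne volume T)] with s hs
      exact signExt_reflect hε hs)
  have hres := Nonresonant.eqOn hp hq hn hT h.nonresonant (parSpace.restrict hT hp hq hv hsym) hw
    (SolvesAE.restrict hT2 extCoeff_eqOn hLv) hLw
    (by
      filter_upwards [ae_restrict_mem measurableSet_Icc] with s hs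
      exact signExt_of_le hs.2)
  refine ⟨hres ht, ?_⟩
  rw [← show _ = ∫ s in (0 : ℝ)..T, G t s * σ s from hres ht]
  exact hsym ⟨ht.1, ht.2.trans hT2⟩

/-- Green's functions on `[0,T]` in terms of the one on `[0,2T]`. -/
lemma IsGreenFunction.eq_add_reflect (hn : 1 ≤ n) (hT : 0 < T) (hp : p ≤ 1) (hq : q ≤ 1)
    (h₂ : IsGreenFunction n (2 * T) (extCoeff n T a) (parSpace p p n (2 * T)) G₂)
    (h : IsGreenFunction n T a (parSpace p q n T) G)
    {t s : ℝ} (ht : t ∈ Icc 0 T) (hs : s ∈ Icc 0 T) :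
    G₂ t s + (-1) ^ (q + 1) * G₂ t (2 * T - s) = G t s ∧
      G₂ (2 * T - t) s + (-1) ^ (q + 1) * G₂ (2 * T - t) (2 * T - s) =
        (-1) ^ (q + 1) * G t s := by
  have hT2 : T ≤ 2 * T := by linarith
  have hG := continuousOn_section h.continuousOn ht
  have hc : ∀ {x}, x ∈ Icc 0 (2 * T) → ContinuousOn (G₂ x) (Icc 0 (2 * T)) := fun hx =>
    continuousOn_section h₂.continuousOn hx
  have hK : ∀ {x}, x ∈ Icc 0 (2 * T) →
      ContinuousOn (fun s => G₂ x s + (-1) ^ (q + 1) * G₂ x (2 * T - s)) (Icc 0 T) := fun hx =>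
    ((hc hx).mono (Icc_subset_Icc_right hT2)).add (continuousOn_const.mul
      ((hc hx).comp (by fun_prop) fun s hs => reflect_mem_Icc hT hs))
  have ht1 : t ∈ Icc 0 (2 * T) := ⟨ht.1, ht.2.trans hT2⟩
  have ht2 := reflect_mem_Icc hT ht
  constructor
  · refine eqOn_zero_of_forall_integral_mul_eq_zero hT (hK ht1) hG (fun σ hσ => ?_) hs
    rw [← integral_mul_signExt hT (hc ht1) hσ]
    exact (integral_signExt hn hT hp hq h₂ h hσ ht).1
  · refine eqOn_zero_of_forall_integral_mul_eq_zero hT (hK ht2)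
      (continuousOn_const.mul hG : ContinuousOn (fun s => (-1) ^ (q + 1) * G t s) _)
      (fun σ hσ => ?_) hs
    rw [← integral_mul_signExt hT (hc ht2) hσ, (integral_signExt hn hT hp hq h₂ h hσ ht).2,
      ← intervalIntegral.integral_const_mul]
    exact integral_congr fun s _ => (mul_assoc _ _ _).symm

/-- The Green's functions on `[0,T]` with conditions of odd and of even parity at `T` are the sum
and the difference of two values of the one on `[0,2T]`. -/
lemma IsGreenFunction.eq_add_and_eq_sub {Go Ge : ℝ → ℝ → ℝ} (hn : 1 ≤ n) (hT : 0 < T) (hp : p ≤ 1)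
    (h₂ : IsGreenFunction n (2 * T) (extCoeff n T a) (parSpace p p n (2 * T)) G₂)
    (ho : IsGreenFunction n T a (parSpace p 1 n T) Go)
    (he : IsGreenFunction n T a (parSpace p 0 n T) Ge)
    {t s : ℝ} (ht : t ∈ Icc 0 T) (hs : s ∈ Icc 0 T) :
    Go t s = G₂ t s + G₂ (2 * T - t) s ∧ Ge t s = G₂ t s - G₂ (2 * T - t) s := by
  obtain ⟨h1, h2⟩ := eq_add_reflect hn hT hp le_rfl h₂ ho ht hs
  obtain ⟨h3, h4⟩ := eq_add_reflect hn hT hp zero_le_one h₂ he ht hs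
  -- With `A, B` the values of `G₂ t` at `s, 2T - s` and `C, D` those of `G₂ (2T - t)`: `A + B = C +
  -- D = Go`, `A - B = D - C = Ge`. Hence `2A = Go + Ge` and `2C = Go - Ge`.
  norm_num at h1 h2 h3 h4
  constructor <;> linarith

lemma abs_sub_le_of_nonneg {x y : ℝ} (hx : 0 ≤ x) (hy : 0 ≤ y) : |x - y| ≤ x + y :=
  abs_le.2 ⟨by linarith, by linarith⟩

lemma add_le_neg_abs_sub_of_nonpos {x y : ℝ} (hx : x ≤ 0) (hy : y ≤ 0) :
    x + y ≤ -|x - y| ∧ (x ≠ 0 → y ≠ 0 → x + y < -|x - y|) := by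
  refine ⟨le_neg.2 (abs_le.2 ⟨by linarith, by linarith⟩), fun hx' hy' => ?_⟩
  have hx'' := lt_of_le_of_ne hx hx'
  have hy'' := lt_of_le_of_ne hy hy'
  exact lt_neg.2 (abs_lt.2 ⟨by linarith, by linarith⟩)

lemma IsGreenFunction.comparison {Go Ge : ℝ → ℝ → ℝ} (hn : 1 ≤ n) (hT : 0 < T) (hp : p ≤ 1)
    (h₂ : IsGreenFunction n (2 * T) (extCoeff n T a) (parSpace p p n (2 * T)) G₂)
    (ho : IsGreenFunction n T a (parSpace p 1 n T) Go)
    (he : IsGreenFunction n T a (parSpace p 0 n T) Ge) :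
    ((∀ t ∈ Icc 0 (2 * T), ∀ s ∈ Icc 0 (2 * T), 0 ≤ G₂ t s) →
        ∀ t ∈ Icc 0 T, ∀ s ∈ Icc 0 T, Go t s ≥ |Ge t s|) ∧
      ((∀ t ∈ Icc 0 (2 * T), ∀ s ∈ Icc 0 (2 * T), G₂ t s ≤ 0) →
        ∀ t ∈ Icc 0 T, ∀ s ∈ Icc 0 T, Go t s ≤ -|Ge t s| ∧
          (G₂ t s ≠ 0 → G₂ (2 * T - t) s ≠ 0 → Go t s < -|Ge t s|)) := by
  have hsub : Icc 0 T ⊆ Icc 0 (2 * T) := Icc_subset_Icc_right (by linarith)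
  constructor <;> intro hsign t ht s hs <;>
    obtain ⟨e1, e2⟩ := eq_add_and_eq_sub hn hT hp h₂ ho he ht hs <;>
    have hx := hsign t (hsub ht) s (hsub hs) <;>
    have hy := hsign (2 * T - t) (reflect_mem_Icc hT ht) s (hsub hs) <;>
    rw [e1, e2]
  · exact abs_sub_le_of_nonneg hx hy
  · exact add_le_neg_abs_sub_of_nonpos hx hy

end Green

theorem mainTheorem8 (n : ℕ) (hn : 1 ≤ n) (T : ℝ) (hT : 0 < T)
    (a : Fin (2 * n) → ℝ → ℝ) (ha : ∀ k, IntegrableOn (a k) (Icc 0 T)) :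
    (∀ GN2 GN GM₁ : ℝ → ℝ → ℝ,
      IsGreenFunction n (2 * T) (extCoeff n T a) (spaceN n (2 * T)) GN2 →
      IsGreenFunction n T a (spaceN n T) GN →
      IsGreenFunction n T a (spaceM₁ n T) GM₁ →
      ((∀ t ∈ Icc 0 (2 * T), ∀ s ∈ Icc 0 (2 * T), 0 ≤ GN2 t s) →
        ∀ t ∈ Icc 0 T, ∀ s ∈ Icc 0 T, GN t s ≥ |GM₁ t s|) ∧
      ((∀ t ∈ Icc 0 (2 * T), ∀ s ∈ Icc 0 (2 * T), GN2 t s ≤ 0) →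
        ∀ t ∈ Icc 0 T, ∀ s ∈ Icc 0 T, GN t s ≤ -|GM₁ t s| ∧
          (GN2 t s ≠ 0 → GN2 (2 * T - t) s ≠ 0 → GN t s < -|GM₁ t s|))) ∧
    (∀ GD2 GD GM₂ : ℝ → ℝ → ℝ,
      IsGreenFunction n (2 * T) (extCoeff n T a) (spaceD n (2 * T)) GD2 →
      IsGreenFunction n T a (spaceD n T) GD →
      IsGreenFunction n T a (spaceM₂ n T) GM₂ →
      ((∀ t ∈ Icc 0 (2 * T), ∀ s ∈ Icc 0 (2 * T), GD2 t s ≤ 0) →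
        ∀ t ∈ Icc 0 T, ∀ s ∈ Icc 0 T, GM₂ t s ≤ -|GD t s| ∧
          (GD2 t s ≠ 0 → GD2 (2 * T - t) s ≠ 0 → GM₂ t s < -|GD t s|)) ∧
      ((∀ t ∈ Icc 0 (2 * T), ∀ s ∈ Icc 0 (2 * T), 0 ≤ GD2 t s) →
        ∀ t ∈ Icc 0 T, ∀ s ∈ Icc 0 T, GM₂ t s ≥ |GD t s|)) := by
  refine ⟨fun GN2 GN GM₁ h₂ ho he => ?_, fun GD2 GD GM₂ h₂ he ho => ?_⟩
  -- The four boundary spaces unfold to `parSpace`: `N`, `D`, `M₁`, `M₂` have `(p, q) = (1,1),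
  -- (0,0), (1,0), (0,1)`. The kernel with odd conditions at `T` is the dominating one: `N` for `p =
  -- 1`, `M₂` for `p = 0`.
  · exact IsGreenFunction.comparison (p := 1) hn hT le_rfl h₂ ho he
  · exact (IsGreenFunction.comparison (p := 0) hn hT zero_le_one h₂ ho he).symm
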